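/- Let $P\subset\mathbb{R}^d$ be a nonempty finite set with a greedy ordering $p_0,\dots,p_n$: the points are distinct, $P_i=\{p_0,\dots,p_{i-1}\}$, and for each $i\ge 1$ the point $p_i$ maximizes the Euclidean distance $\mathbf d(p,P_i)$ to $P_i$ over all $p\in P$. Let $r_i=\mathbf d(p_i,P_i)$, with $r_0=\infty$. Fix $\varepsilon>0$ and let the freezing times be \[ \lambda_i=(1+\varepsilon)^{\left\lceil\log_{1+\varepsilon}\left(\frac{1+\varepsilon}{\varepsilon}r_i\right)\right\rceil}\quad(i\ge 1),\qquad \lambda_0=\infty . \] For $\alpha\ge 0$ let $w_i(\alpha)=0$ if $\alpha<\lambda_i$ and $w_i(\alpha)=\sqrt{\alpha^2-\lambda_i^2}$ otherwise, let $\pi_{i,\alpha}(x)=\sqrt{\|x-p_i\|^2+w_i(\alpha)^2}$, and define \[ \hat P^\alpha=\Big\{x\in\mathbb{R}^d : \min_j\pi_{j,\alpha}(x)\le\alpha\Big\},\qquad V_i^\alpha=\Big\{x\in\mathbb{R}^d : \pi_{i,\alpha}(x)=\min_j\pi_{j,\alpha}(x),\ \|x-p_i\|\le\min\{\alpha,\lambda_i\}\Big\}.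 \] Let the lifted offsets and the lifted clipped Voronoi cells be \[ \hat P_+^\alpha=\{(x,\gamma)\in\mathbb{R}^d\times[0,\alpha] : x\in\hat P^\gamma\},\qquad V_{+i}^\alpha=\{(x,\gamma)\in\mathbb{R}^d\times[0,\alpha] : x\in V_i^\gamma\}. \] For $\gamma\ge 0$ let $D^\gamma$ be the set of nonempty $\sigma\subseteq\{0,\dots,n\}$ with $\bigcap_{i\in\sigma}V_i^\gamma\ne\emptyset$. The $\varepsilon$-sparse Delaunay filtration is $D_+^\alpha=\bigcup_{\gamma\in[0,\alpha]}D^\gamma$. Then the family $(V_{+i}^\alpha)$ is a good filtered cover of $(\hat P_+^\alpha)$ whose nerve is $(D_+^\alpha)$, and hence, up to the homotopy equivalence given by projection, a good filtered cover of $(\hat P^\alpha)$. That is: 1. $V_{+i}^\alpha\subseteq V_{+i}^\beta$ for all $i$ and all $0\le\alpha\le\beta$. 2. For every $\alpha\ge 0$, $\bigcup_i V_{+i}^\alpha=\hat P_+^\alpha$. 3. For every $\alpha\ge 0$ and every nonempty $\sigma\subseteq\{0,\dots,n\}$, the intersection $\bigcap_{i\in\sigma}V_{+i}^\alpha$ is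 either empty or contractible. 4. For every $\alpha\ge 0$ and every nonempty $\sigma\subseteq\{0,\dots,n\}$, $\bigcap_{i\in\sigma}V_{+i}^\alpha\neq\emptyset$ if and only if $\sigma\in D_+^\alpha$. 5. For every $\alpha\ge 0$, the projection $\hat P_+^\alpha\to\hat P^\alpha$, $(x,\gamma)\mapsto x$, is a homotopy equivalence. -/

import Mathlib

open scoped ENNReal ContinuousMap

namespace SparseDelaunay

noncomputable section

/-- Euclidean space of dimension `d`. -/
abbrev Pt (d : ℕ) : Type := EuclideanSpace ℝ (Fin d)

section Covers

variable {ι X : Type*}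

/-- The (indexed) nerve of a family of sets: the nonempty finite sets of indices whose members
have a common point. -/
def nerve (U : ι → Set X) : Set (Finset ι) :=
  {σ | σ.Nonempty ∧ (⋂ i ∈ σ, U i).Nonempty}

/-- A family of sets indexed by `i` and by a scale `α ≥ 0` is a good filtered cover of the family
`W`: every `U i` is a filtration, at every scale the sets `U i α` cover exactly `W α`, and every
nonempty intersection of finitely many (at least one) of them is contractible. -/
structure IsGoodFilteredCover [TopologicalSpace X] (U : ι → ℝ → Set X) (W : ℝ → Set X) :
    Prop where
  filtered : ∀ i α β, 0 ≤ α → α ≤ β → U i α ⊆ U i β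
  cover : ∀ α, 0 ≤ α → ⋃ i, U i α = W α
  good : ∀ α, 0 ≤ α → ∀ σ ∈ nerve (fun i => U i α),
    ContractibleSpace ↥(⋂ i ∈ σ, U i α)

end Covers

variable {d n : ℕ}

/-- The prefix `P_i = {p_0, …, p_{i-1}}` of an ordered point set. -/
def prefixSet (p : Fin (n + 1) → Pt d) (i : Fin (n + 1)) : Set (Pt d) :=
  {x | ∃ j, j < i ∧ p j = x}

/-- `p` is a greedy ordering of a set of `n + 1` points: the points are distinct, and each point
after the first one is farthest, among all the points, from the set of its predecessors. -/
structure IsGreedyOrdering (p : Fin (n + 1) → Pt d) : Prop where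
  injective : Function.Injective p
  farthest : ∀ i, i ≠ 0 → ∀ j,
    Metric.infEDist (p j) (prefixSet p i) ≤ Metric.infEDist (p i) (prefixSet p i)

/-- The insertion radius `r_i = d(p_i, P_i)`. The distance to the empty set is infinite, so that
`r_0 = ∞`, and `r_i` is finite for every other `i`. -/
def insertionRadius (p : Fin (n + 1) → Pt d) (i : Fin (n + 1)) : ℝ≥0∞ :=
  Metric.infEDist (p i) (prefixSet p i)

/-- The freezing time `λ_i = (1 + ε) ^ ⌈log_{1+ε} ((1 + ε) / ε * r_i)⌉`, with `λ_0 = ∞` because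
`r_0 = ∞` (the first point never freezes). -/
def freezingTime (ε : ℝ) (p : Fin (n + 1) → Pt d) (i : Fin (n + 1)) : ℝ≥0∞ :=
  if insertionRadius p i = ∞ then ∞
  else ENNReal.ofReal
    ((1 + ε) ^ (⌈Real.logb (1 + ε) ((1 + ε) / ε * (insertionRadius p i).toReal)⌉ : ℤ))

/-- The weight `w_i(α)` of the `i`-th point at scale `α`. -/
def weight (ε : ℝ) (p : Fin (n + 1) → Pt d) (α : ℝ) (i : Fin (n + 1)) : ℝ :=
  if ENNReal.ofReal α < freezingTime ε p i then 0
  else Real.sqrt (α ^ 2 - (freezingTime ε p i).toReal ^ 2)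

/-- The weighted distance from `x` to the `i`-th point with its weight at scale `α`. -/
def weightedDist (ε : ℝ) (p : Fin (n + 1) → Pt d) (α : ℝ) (i : Fin (n + 1)) (x : Pt d) : ℝ :=
  Real.sqrt (‖x - p i‖ ^ 2 + weight ε p α i ^ 2)

/-- The distance from `x` to the weighted point set at scale `α`; the infimum is a minimum over
finitely many points. -/
def distWeighted (ε : ℝ) (p : Fin (n + 1) → Pt d) (α : ℝ) (x : Pt d) : ℝ :=
  ⨅ i, weightedDist ε p α i x

/-- The offset of the weighted point set at scale `α`. -/
def offset (ε : ℝ) (p : Fin (n + 1) → Pt d) (α : ℝ) : Set (Pt d) :=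
  {x | distWeighted ε p α x ≤ α}

/-- The weighted Voronoi cell of the `i`-th point at scale `α`. -/
def voronoiCell (ε : ℝ) (p : Fin (n + 1) → Pt d) (α : ℝ) (i : Fin (n + 1)) : Set (Pt d) :=
  {x | weightedDist ε p α i x = distWeighted ε p α x}

/-- The clipped Voronoi cell: the Voronoi cell at scale `α` intersected with the closed Euclidean
ball of radius `min {α, λ_i}` around `p_i`. -/
def clippedCell (ε : ℝ) (p : Fin (n + 1) → Pt d) (α : ℝ) (i : Fin (n + 1)) : Set (Pt d) :=
  voronoiCell ε p α i ∩ Metric.closedEBall (p i) (min (ENNReal.ofReal α) (freezingTime ε p i))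

/-- The lifted clipped Voronoi cell: its slice at each height `γ ∈ [0, α]` is the clipped Voronoi
cell at scale `γ`. -/
def liftedCell (ε : ℝ) (p : Fin (n + 1) → Pt d) (i : Fin (n + 1)) (α : ℝ) : Set (Pt d × ℝ) :=
  {z | z.2 ∈ Set.Icc 0 α ∧ z.1 ∈ clippedCell ε p z.2 i}

/-- The lifted weighted offset: its slice at each height `γ ∈ [0, α]` is the offset at
scale `γ`. -/
def liftedOffset (ε : ℝ) (p : Fin (n + 1) → Pt d) (α : ℝ) : Set (Pt d × ℝ) :=
  {z | z.2 ∈ Set.Icc 0 α ∧ z.1 ∈ offset ε p z.2}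

/-- The Delaunay complex at scale `α`, on the vertex set of indices of the points. -/
def delaunay (ε : ℝ) (p : Fin (n + 1) → Pt d) (α : ℝ) : Set (Finset (Fin (n + 1))) :=
  nerve (clippedCell ε p α)

/-- The sparse Delaunay filtration at scale `α`: the union of the Delaunay complexes at all
scales `γ ∈ [0, α]`. -/
def sparseDelaunay (ε : ℝ) (p : Fin (n + 1) → Pt d) (α : ℝ) : Set (Finset (Fin (n + 1))) :=
  ⋃ γ ∈ Set.Icc 0 α, delaunay ε p γ

end

end SparseDelaunay

/-!
Write `ρ_i(γ) = min {γ, λ_i}`. At every scale `γ ≥ 0` the weighted distance satisfies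
`π_{i,γ}(x)² = γ² + f_i(x)` with `f_i(x) = ‖x - p_i‖² - ρ_i(γ)²`, the power of `x` with respect to
the ball of radius `ρ_i(γ)` around `p_i`. Hence the offset is the union of these balls
(`mem_offset_iff`), and a clipped cell is the set where `f_i ≤ 0` and `f_i` is the least of all the
powers (`mem_clippedCell_iff`). The covering property and the description of the nerve follow
at once. As the balls only grow, so do the offsets, and raising every point of the lifted offset
to the top height is a homotopy inverse to the projection.

For the contractibility of an intersection of lifted cells over `σ`, let `λ` be the least freezing
time of a vertex of `σ`, attained at `i`, and let `μ = min {α, λ}`. Below height `μ` no ball of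
`σ` is frozen, and the common slices grow with the height (`clippedCell_subset_of_le`), so that
this part can be pushed up vertically to height `μ`. Above height `μ`, the cell of the
frozen point `p_i` is empty from height `(1 + ε) λ` on (`lt_of_mem_clippedCell`): the greedy order
provides a point `p_j` that freezes later and is so near that its ball has swallowed the ball
of `p_i`. Since freezing times are powers of `1 + ε`, no freezing time lies strictly between `λ`
and `(1 + ε) λ`. So, on the heights that matter, each `ρ_l(γ)²` is either constant or equal to
`γ²`, and in the coordinates `(x, γ²)` the conditions `f_i ≤ f_l` become affine and `f_i ≤ 0`
convex (`convex_powerCells`). The upper part is thus homeomorphic to a convex set.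
-/

namespace SparseDelaunay

/-! ### Vertical deformations -/

/-- The homotopy that raises the height of every point to at least `μ`. -/
def raiseHomotopy {E : Type*} [TopologicalSpace E] {S : Set (E × ℝ)} {μ : ℝ} (hμ : 0 ≤ μ)
    (hS : ∀ z ∈ S, 0 ≤ z.2)
    (hup : ∀ x γ γ', (x, γ) ∈ S → γ ≤ γ' → γ' ≤ μ → (x, γ') ∈ S)
    (g : C(S, S)) (hg : ∀ z, (g z : E × ℝ) = (z.1.1, max z.1.2 μ)) :
    (ContinuousMap.id S).Homotopy g where
  toFun q := ⟨(q.2.1.1, max q.2.1.2 (q.1 * μ)), by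
    rcases le_total (q.1 * μ) q.2.1.2 with h | h
    · rw [max_eq_left h]
      exact q.2.2
    · rw [max_eq_right h]
      exact hup _ _ _ q.2.2 h (mul_le_of_le_one_left hμ q.1.2.2)⟩
  continuous_toFun := by fun_prop
  map_zero_left z := by
    apply Subtype.ext
    simp [max_eq_left (hS _ z.2)]
  map_one_left z := by
    apply Subtype.ext
    simp [hg]

/-- A set that can be pushed up to height `μ`, and whose part above height `μ` is convex after
squaring the height, is contractible. -/
theorem contractibleSpace_of_raise_of_convex {E : Type*} [NormedAddCommGroup E] [NormedSpace ℝ E]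
    {S : Set (E × ℝ)} {μ : ℝ} (hμ : 0 ≤ μ) (hS : ∀ z ∈ S, 0 ≤ z.2)
    (hup : ∀ x γ γ', (x, γ) ∈ S → γ ≤ γ' → γ' ≤ μ → (x, γ') ∈ S)
    (hconv : Convex ℝ {z : E × ℝ | μ ^ 2 ≤ z.2 ∧ (z.1, √z.2) ∈ S})
    (hne : S.Nonempty) : ContractibleSpace S := by
  set C : Set (E × ℝ) := {z | μ ^ 2 ≤ z.2 ∧ (z.1, √z.2) ∈ S} with hC
  have hraise : ∀ z ∈ S, (z.1, max z.2 μ) ∈ S := by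
    intro z hz
    rcases le_total μ z.2 with h | h
    · rwa [max_eq_left h]
    · rw [max_eq_right h]
      exact hup _ _ _ hz h le_rfl
  let f : C(S, C) :=
    { toFun := fun z => ⟨(z.1.1, (max z.1.2 μ) ^ 2), by
        refine ⟨pow_le_pow_left₀ hμ (le_max_right _ _) 2, ?_⟩
        simpa only [Real.sqrt_sq (hμ.trans (le_max_right _ _))] using hraise _ z.2⟩
      continuous_toFun := by fun_prop }
  let g : C(C, S) :=
    { toFun := fun z => ⟨(z.1.1, √z.1.2), z.2.2⟩
      continuous_toFun := by fun_prop }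
  let e : S ≃ₕ C :=
    { toFun := f
      invFun := g
      left_inv := ⟨(raiseHomotopy hμ hS hup (g.comp f) fun z => by
        simp [f, g, Real.sqrt_sq (hμ.trans (le_max_right _ _))]).symm⟩
      right_inv := by
        convert ContinuousMap.Homotopic.refl _
        ext1 z
        apply Subtype.ext
        have h0 : 0 ≤ z.1.2 := (sq_nonneg μ).trans z.2.1
        have h1 : μ ≤ √z.1.2 := Real.le_sqrt_of_sq_le z.2.1
        simp [f, g, max_eq_left h1, Real.sq_sqrt h0] }
  obtain ⟨z, hz⟩ := hne
  have : ContractibleSpace C := hconv.contractibleSpace ⟨_, (f ⟨z, hz⟩).2⟩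
  exact e.contractibleSpace

/-! ### Power cells of a family of balls -/

section Power

variable {E ι : Type*} [NormedAddCommGroup E] [InnerProductSpace ℝ E]

theorem norm_convexComb_sub_sq (x y q : E) {a b : ℝ} (hab : a + b = 1) :
    ‖a • x + b • y - q‖ ^ 2 = a * ‖x - q‖ ^ 2 + b * ‖y - q‖ ^ 2 - a * b * ‖x - y‖ ^ 2 := by
  obtain rfl : b = 1 - a := by linarith
  have h1 : a • x + (1 - a) • y - q = a • (x - q) + (1 - a) • (y - q) := by module
  have h2 : x - y = (x - q) - (y - q) := by abel
  rw [h1, h2, norm_add_sq_real, norm_sub_sq_real (x - q), norm_smul, norm_smul, mul_pow, mul_pow,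
    inner_smul_left, inner_smul_right, Real.norm_eq_abs, Real.norm_eq_abs, sq_abs, sq_abs]
  simp only [conj_trivial]
  ring

/-- If the squared radii of balls are affine functions of a parameter `t`, the total space over `t`
of their clipped power cells is convex: the quadratic terms of two powers cancel. -/
theorem convex_powerCells (p : ι → E) (σ : Set ι) {J : Set ℝ} (hJ : Convex ℝ J) (A B : ι → ℝ) :
    Convex ℝ {z : E × ℝ | z.2 ∈ J ∧ ∀ i ∈ σ, ‖z.1 - p i‖ ^ 2 ≤ A i + B i * z.2 ∧
      ∀ j, ‖z.1 - p i‖ ^ 2 - (A i + B i * z.2) ≤ ‖z.1 - p j‖ ^ 2 - (A j + B j * z.2)} := by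
  rintro ⟨x, s⟩ ⟨hs, hx⟩ ⟨y, t⟩ ⟨ht, hy⟩ a b ha hb hab
  refine ⟨hJ hs ht ha hb hab, fun i hi => ?_⟩
  obtain ⟨hx1, hx2⟩ := hx i hi
  obtain ⟨hy1, hy2⟩ := hy i hi
  have hA : ∀ j, A j = a * A j + b * A j := fun j => by rw [← add_mul, hab, one_mul]
  simp only [Prod.fst_add, Prod.snd_add, Prod.smul_fst, Prod.smul_snd, smul_eq_mul,
    norm_convexComb_sub_sq x y _ hab] at *
  have h0 : 0 ≤ a * b * ‖x - y‖ ^ 2 := by positivity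
  refine ⟨?_, fun j => ?_⟩
  · have h1 := mul_le_mul_of_nonneg_left hx1 ha
    have h2 := mul_le_mul_of_nonneg_left hy1 hb
    have := hA i
    linarith
  · have h1 := mul_le_mul_of_nonneg_left (hx2 j) ha
    have h2 := mul_le_mul_of_nonneg_left (hy2 j) hb
    have := hA i
    have := hA j
    linarith

end Power

variable {d n : ℕ} {ε : ℝ} {p : Fin (n + 1) → Pt d}

/-! ### Freezing times -/

theorem insertionRadius_zero (p : Fin (n + 1) → Pt d) : insertionRadius p 0 = ∞ := by
  have : prefixSet p 0 = ∅ := by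
    ext x
    simp [prefixSet]
  rw [insertionRadius, this, Metric.infEDist_empty]

theorem freezingTime_zero (ε : ℝ) (p : Fin (n + 1) → Pt d) : freezingTime ε p 0 = ∞ := by
  rw [freezingTime, if_pos (insertionRadius_zero p)]

theorem freezingTime_eq_zpow {i : Fin (n + 1)} (h : freezingTime ε p i ≠ ∞) :
    ∃ k : ℤ, freezingTime ε p i = ENNReal.ofReal ((1 + ε) ^ k) := by
  unfold freezingTime at h ⊢
  split_ifs at h ⊢
  · exact absurd rfl h
  · exact ⟨_, rfl⟩

theorem freezingTime_toReal_pos (hε : 0 < ε) {i : Fin (n + 1)} (h : freezingTime ε p i ≠ ∞) :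
    0 < (freezingTime ε p i).toReal := by
  obtain ⟨k, hk⟩ := freezingTime_eq_zpow h
  have : 0 < (1 + ε) ^ k := by positivity
  rwa [hk, ENNReal.toReal_ofReal this.le]

/-- Consecutive freezing times differ by a factor of at least `1 + ε`. -/
theorem freezingTime_gap (hε : 0 < ε) {i j : Fin (n + 1)}
    (hij : freezingTime ε p i < freezingTime ε p j) :
    ENNReal.ofReal ((1 + ε) * (freezingTime ε p i).toReal) ≤ freezingTime ε p j := by
  by_cases hj : freezingTime ε p j = ∞
  · simp [hj]
  obtain ⟨k, hk⟩ := freezingTime_eq_zpow (hij.trans_le le_top).ne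
  obtain ⟨l, hl⟩ := freezingTime_eq_zpow hj
  have h1 : 0 < 1 + ε := by positivity
  rw [hk, hl] at hij
  rw [hk, hl, ENNReal.toReal_ofReal (by positivity)]
  have hkl : k < l := by
    rw [ENNReal.ofReal_lt_ofReal_iff (by positivity)] at hij
    exact (zpow_lt_zpow_iff_right₀ (by linarith)).1 hij
  apply ENNReal.ofReal_le_ofReal
  rw [← zpow_one_add₀ h1.ne']
  exact zpow_le_zpow_right₀ (by linarith) (by omega)

theorem prefixSet_finite (p : Fin (n + 1) → Pt d) (i : Fin (n + 1)) : (prefixSet p i).Finite :=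
  (Set.finite_range p).subset (by rintro _ ⟨j, -, rfl⟩; exact ⟨j, rfl⟩)

theorem insertionRadius_ne_zero (hp : IsGreedyOrdering p) (i : Fin (n + 1)) :
    insertionRadius p i ≠ 0 := by
  intro h
  obtain ⟨j, hj, hji⟩ := (Metric.mem_iff_infEDist_zero_of_closed (prefixSet_finite p i).isClosed).2 h
  exact hj.ne (hp.injective hji)

/-- Rounding the exponent up gives `(1 + ε) / ε * r_i ≤ λ_i`. -/
theorem insertionRadius_le (hε : 0 < ε) (hp : IsGreedyOrdering p) {i : Fin (n + 1)}
    (h : freezingTime ε p i ≠ ∞) :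
    insertionRadius p i ≤ ENNReal.ofReal (ε / (1 + ε) * (freezingTime ε p i).toReal) := by
  have hr : insertionRadius p i ≠ ∞ := by
    intro hr
    exact h (by rw [freezingTime, if_pos hr])
  have hpos : 0 < (insertionRadius p i).toReal :=
    ENNReal.toReal_pos (insertionRadius_ne_zero hp i) hr
  rw [← ENNReal.ofReal_toReal hr]
  apply ENNReal.ofReal_le_ofReal
  rw [freezingTime, if_neg hr, ENNReal.toReal_ofReal (by positivity)]
  set r := (insertionRadius p i).toReal
  have h1 : (1 + ε) / ε * r ≤ (1 + ε) ^ ⌈Real.logb (1 + ε) ((1 + ε) / ε * r)⌉ := by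
    rw [← Real.rpow_intCast, ← Real.logb_le_iff_le_rpow (by linarith) (by positivity)]
    exact Int.le_ceil _
  calc r = ε / (1 + ε) * ((1 + ε) / ε * r) := by field_simp
    _ ≤ _ := mul_le_mul_of_nonneg_left h1 (by positivity)

/-- Every point that freezes at time `λ` is within `ε / (1 + ε) * λ` of a point that freezes later:
the first point `p_k` with `λ_k ≤ λ` is farthest from its prefix, whose points freeze after `λ`. -/
theorem exists_near_later (hε : 0 < ε) (hp : IsGreedyOrdering p) {i : Fin (n + 1)}
    (h : freezingTime ε p i ≠ ∞) :
    ∃ j, freezingTime ε p i < freezingTime ε p j ∧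
      ‖p i - p j‖ ≤ ε / (1 + ε) * (freezingTime ε p i).toReal := by
  obtain ⟨k, hk, hmin⟩ := WellFounded.has_min (wellFounded_lt (α := Fin (n + 1)))
    {k | freezingTime ε p k ≤ freezingTime ε p i} ⟨i, le_refl (freezingTime ε p i)⟩
  have hk' : freezingTime ε p k ≤ freezingTime ε p i := hk
  have hkt : freezingTime ε p k ≠ ∞ := ne_top_of_le_ne_top h hk'
  have hk0 : k ≠ 0 := by
    rintro rfl
    exact hkt (freezingTime_zero ε p)
  have hne : (prefixSet p k).Nonempty := ⟨p 0, 0, Fin.pos_iff_ne_zero.2 hk0, rfl⟩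
  obtain ⟨_, ⟨j, hjk, rfl⟩, hj⟩ := (prefixSet_finite p k).isCompact.exists_infEDist_eq_edist hne (p i)
  refine ⟨j, not_le.1 fun hle => hmin j hle hjk, ?_⟩
  have h1 : edist (p i) (p j) ≤
      ENNReal.ofReal (ε / (1 + ε) * (freezingTime ε p i).toReal) := by
    rw [← hj]
    refine (hp.farthest k hk0 i).trans ((insertionRadius_le hε hp hkt).trans ?_)
    have := ENNReal.toReal_mono h hk'
    gcongr
  rwa [edist_le_ofReal (by positivity), dist_eq_norm] at h1

/-! ### Weighted distances as powers of balls -/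

/-- The radius `min {γ, λ_i}` of the ball around the `i`-th point at scale `γ`, as a real number. -/
noncomputable def cappedRadius (ε : ℝ) (p : Fin (n + 1) → Pt d) (γ : ℝ) (i : Fin (n + 1)) : ℝ :=
  (min (ENNReal.ofReal γ) (freezingTime ε p i)).toReal

theorem cappedRadius_nonneg (γ : ℝ) (i : Fin (n + 1)) : 0 ≤ cappedRadius ε p γ i :=
  ENNReal.toReal_nonneg

theorem cappedRadius_of_le {γ : ℝ} (hγ : 0 ≤ γ) {i : Fin (n + 1)}
    (h : ENNReal.ofReal γ ≤ freezingTime ε p i) : cappedRadius ε p γ i = γ := by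
  rw [cappedRadius, min_eq_left h, ENNReal.toReal_ofReal hγ]

theorem cappedRadius_of_ge {γ : ℝ} {i : Fin (n + 1)}
    (h : freezingTime ε p i ≤ ENNReal.ofReal γ) :
    cappedRadius ε p γ i = (freezingTime ε p i).toReal := by
  rw [cappedRadius, min_eq_right h]

theorem cappedRadius_mono {γ γ' : ℝ} (h : γ ≤ γ') (i : Fin (n + 1)) :
    cappedRadius ε p γ i ≤ cappedRadius ε p γ' i :=
  ENNReal.toReal_mono (ne_top_of_le_ne_top ENNReal.ofReal_ne_top (min_le_left _ _))
    (min_le_min_right _ (ENNReal.ofReal_le_ofReal h))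

/-- The squared weight `γ² - min {γ, λ_i}²` grows with the scale. -/
theorem sq_sub_cappedRadius_sq_mono {γ γ' : ℝ} (hγ : 0 ≤ γ) (h : γ ≤ γ') (i : Fin (n + 1)) :
    γ ^ 2 - cappedRadius ε p γ i ^ 2 ≤ γ' ^ 2 - cappedRadius ε p γ' i ^ 2 := by
  rcases le_total (ENNReal.ofReal γ') (freezingTime ε p i) with h1 | h1
  · rw [cappedRadius_of_le (hγ.trans h) h1,
      cappedRadius_of_le hγ ((ENNReal.ofReal_le_ofReal h).trans h1)]
    simp
  have hsq : γ ^ 2 ≤ γ' ^ 2 := pow_le_pow_left₀ hγ h 2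
  rcases le_total (ENNReal.ofReal γ) (freezingTime ε p i) with h2 | h2
  · rw [cappedRadius_of_le hγ h2, cappedRadius_of_ge h1]
    have h3 : (freezingTime ε p i).toReal ≤ γ' := ENNReal.toReal_le_of_le_ofReal (hγ.trans h) h1
    have := pow_le_pow_left₀ ENNReal.toReal_nonneg h3 2
    linarith
  · rw [cappedRadius_of_ge h1, cappedRadius_of_ge h2]
    linarith

theorem weight_sq {γ : ℝ} (hγ : 0 ≤ γ) (i : Fin (n + 1)) :
    weight ε p γ i ^ 2 = γ ^ 2 - cappedRadius ε p γ i ^ 2 := by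
  unfold weight
  split_ifs with h
  · simp [cappedRadius_of_le hγ h.le]
  · rw [not_lt] at h
    have := pow_le_pow_left₀ ENNReal.toReal_nonneg (ENNReal.toReal_le_of_le_ofReal hγ h) 2
    rw [Real.sq_sqrt (by linarith), cappedRadius_of_ge h]

/-- The power of `x` with respect to the ball around the `i`-th point at scale `γ`. -/
noncomputable def power (ε : ℝ) (p : Fin (n + 1) → Pt d) (γ : ℝ) (i : Fin (n + 1)) (x : Pt d) : ℝ :=
  ‖x - p i‖ ^ 2 - cappedRadius ε p γ i ^ 2

theorem weightedDist_eq {γ : ℝ} (hγ : 0 ≤ γ) (i : Fin (n + 1)) (x : Pt d) :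
    weightedDist ε p γ i x = √(γ ^ 2 + power ε p γ i x) := by
  rw [weightedDist, weight_sq hγ, power]
  congr 1
  ring

theorem sq_add_power_nonneg {γ : ℝ} (hγ : 0 ≤ γ) (i : Fin (n + 1)) (x : Pt d) :
    0 ≤ γ ^ 2 + power ε p γ i x := by
  have h := weight_sq (ε := ε) (p := p) hγ i
  have := sq_nonneg (weight ε p γ i)
  have := sq_nonneg ‖x - p i‖
  unfold power
  linarith

theorem weightedDist_le_weightedDist_iff {γ : ℝ} (hγ : 0 ≤ γ) (i j : Fin (n + 1)) (x : Pt d) :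
    weightedDist ε p γ i x ≤ weightedDist ε p γ j x ↔ power ε p γ i x ≤ power ε p γ j x := by
  rw [weightedDist_eq hγ, weightedDist_eq hγ, Real.sqrt_le_sqrt_iff (sq_add_power_nonneg hγ j x),
    add_le_add_iff_left]

theorem weightedDist_le_iff {γ : ℝ} (hγ : 0 ≤ γ) (i : Fin (n + 1)) (x : Pt d) :
    weightedDist ε p γ i x ≤ γ ↔ power ε p γ i x ≤ 0 := by
  rw [weightedDist_eq hγ, Real.sqrt_le_left hγ]
  simp

theorem power_nonpos_iff {γ : ℝ} {i : Fin (n + 1)} {x : Pt d} :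
    power ε p γ i x ≤ 0 ↔ ‖x - p i‖ ≤ cappedRadius ε p γ i := by
  rw [power, sub_nonpos, sq_le_sq₀ (norm_nonneg _) (cappedRadius_nonneg γ i)]

theorem mem_closedEBall_min_iff {γ : ℝ} {i : Fin (n + 1)} {x : Pt d} :
    x ∈ Metric.closedEBall (p i) (min (ENNReal.ofReal γ) (freezingTime ε p i)) ↔
      power ε p γ i x ≤ 0 := by
  have hfin : min (ENNReal.ofReal γ) (freezingTime ε p i) ≠ ∞ :=
    ne_top_of_le_ne_top ENNReal.ofReal_ne_top (min_le_left _ _)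
  rw [power_nonpos_iff, Metric.mem_closedEBall, ← ENNReal.ofReal_toReal hfin,
    edist_le_ofReal ENNReal.toReal_nonneg, dist_eq_norm, cappedRadius]

theorem weightedDist_eq_distWeighted_iff {γ : ℝ} {i : Fin (n + 1)} {x : Pt d} :
    weightedDist ε p γ i x = distWeighted ε p γ x ↔
      ∀ j, weightedDist ε p γ i x ≤ weightedDist ε p γ j x := by
  have hbdd : BddBelow (Set.range fun j => weightedDist ε p γ j x) :=
    (Set.finite_range _).bddBelow
  constructor
  · intro h j
    rw [h]
    exact ciInf_le hbdd j
  · intro h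
    exact le_antisymm (le_ciInf h) (ciInf_le hbdd i)

theorem mem_clippedCell_iff {γ : ℝ} (hγ : 0 ≤ γ) {i : Fin (n + 1)} {x : Pt d} :
    x ∈ clippedCell ε p γ i ↔
      power ε p γ i x ≤ 0 ∧ ∀ j, power ε p γ i x ≤ power ε p γ j x := by
  rw [clippedCell, Set.mem_inter_iff, mem_closedEBall_min_iff, and_comm, voronoiCell,
    Set.mem_ofPred_eq, weightedDist_eq_distWeighted_iff]
  simp only [weightedDist_le_weightedDist_iff hγ]

theorem mem_offset_iff {γ : ℝ} (hγ : 0 ≤ γ) {x : Pt d} :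
    x ∈ offset ε p γ ↔ ∃ i, power ε p γ i x ≤ 0 := by
  obtain ⟨i, hi⟩ := exists_eq_ciInf_of_finite (f := fun j => weightedDist ε p γ j x)
  have hi' : weightedDist ε p γ i x = distWeighted ε p γ x := hi
  constructor
  · intro h
    exact ⟨i, (weightedDist_le_iff hγ i x).1 (hi'.trans_le h)⟩
  · rintro ⟨j, hj⟩
    exact hi'.symm.trans_le ((weightedDist_eq_distWeighted_iff.1 hi' j).trans
      ((weightedDist_le_iff hγ j x).2 hj))

theorem iUnion_clippedCell {γ : ℝ} (hγ : 0 ≤ γ) : ⋃ i, clippedCell ε p γ i = offset ε p γ := by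
  ext x
  rw [Set.mem_iUnion, mem_offset_iff hγ]
  constructor
  · rintro ⟨i, hi⟩
    exact ⟨i, ((mem_clippedCell_iff hγ).1 hi).1⟩
  · rintro ⟨j, hj⟩
    obtain ⟨i, hi⟩ := Finite.exists_min fun i => power ε p γ i x
    exact ⟨i, (mem_clippedCell_iff hγ).2 ⟨(hi j).trans hj, hi⟩⟩

theorem offset_mono {γ γ' : ℝ} (hγ : 0 ≤ γ) (h : γ ≤ γ') : offset ε p γ ⊆ offset ε p γ' := by
  intro x hx
  obtain ⟨i, hi⟩ := (mem_offset_iff hγ).1 hx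
  exact (mem_offset_iff (hγ.trans h)).2
    ⟨i, power_nonpos_iff.2 ((power_nonpos_iff.1 hi).trans (cappedRadius_mono h i))⟩

/-! ### Growth and disappearance of the clipped cells -/

/-- Before its point freezes, a clipped cell grows with the scale. -/
theorem clippedCell_subset_of_le {γ γ' : ℝ} (hγ : 0 ≤ γ) (h : γ ≤ γ') {i : Fin (n + 1)}
    (hi : ENNReal.ofReal γ' ≤ freezingTime ε p i) :
    clippedCell ε p γ i ⊆ clippedCell ε p γ' i := by
  intro x hx
  have hγ' := hγ.trans h
  rw [mem_clippedCell_iff hγ] at hx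
  rw [mem_clippedCell_iff hγ']
  refine ⟨power_nonpos_iff.2 ((power_nonpos_iff.1 hx.1).trans (cappedRadius_mono h i)), fun j => ?_⟩
  have h1 := hx.2 j
  have h2 := sq_sub_cappedRadius_sq_mono (ε := ε) (p := p) hγ h j
  unfold power at h1 ⊢
  rw [cappedRadius_of_le hγ ((ENNReal.ofReal_le_ofReal h).trans hi)] at h1
  rw [cappedRadius_of_le hγ' hi]
  linarith

/-- The clipped cell of a point with freezing time `λ` is empty from scale `(1 + ε) λ` on. -/
theorem lt_of_mem_clippedCell (hε : 0 < ε) (hp : IsGreedyOrdering p) {γ : ℝ} (hγ : 0 ≤ γ)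
    {i : Fin (n + 1)} {x : Pt d} (hx : x ∈ clippedCell ε p γ i) (h : freezingTime ε p i ≠ ∞) :
    γ < (1 + ε) * (freezingTime ε p i).toReal := by
  by_contra! hle
  -- For the later-freezing neighbour `p_j`, with `δ = ε / (1 + ε) * λ`, comparing powers at `x`
  -- gives `((1 + ε) λ)² ≤ λ² + 2 ‖x - p_i‖ δ + δ² ≤ (λ + δ)²`, which fails because `δ < ε λ`.
  obtain ⟨j, hij, hd⟩ := exists_near_later hε hp h
  have hgap := freezingTime_gap hε hij
  have hpos := freezingTime_toReal_pos hε h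
  obtain ⟨h0, h1⟩ := (mem_clippedCell_iff hγ).1 hx
  have hlam : freezingTime ε p i ≤ ENNReal.ofReal γ := by
    rw [← ENNReal.ofReal_toReal h]
    exact ENNReal.ofReal_le_ofReal (by nlinarith)
  rw [power_nonpos_iff, cappedRadius_of_ge hlam] at h0
  have hR : (1 + ε) * (freezingTime ε p i).toReal ≤ cappedRadius ε p γ j := by
    rw [cappedRadius, ← ENNReal.ofReal_le_iff_le_toReal
      (ne_top_of_le_ne_top ENNReal.ofReal_ne_top (min_le_left _ _))]
    exact le_min (ENNReal.ofReal_le_ofReal hle) hgap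
  have h2 := h1 j
  simp only [power] at h2
  rw [cappedRadius_of_ge hlam] at h2
  set l := (freezingTime ε p i).toReal
  set δ := ε / (1 + ε) * l with hδ
  have hδ0 : 0 < δ := by positivity
  have hδl : δ < ε * l := by
    rw [hδ]
    apply mul_lt_mul_of_pos_right _ hpos
    exact div_lt_self hε (by linarith)
  have htri : ‖x - p j‖ ≤ ‖x - p i‖ + δ := (norm_sub_le_norm_sub_add_norm_sub _ (p i) _).trans
    (add_le_add_right hd _)
  have hsq1 := pow_le_pow_left₀ (norm_nonneg _) htri 2
  have hsq2 := pow_le_pow_left₀ (by positivity) hR 2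
  have hsq3 : (l + δ) ^ 2 < ((1 + ε) * l) ^ 2 :=
    pow_lt_pow_left₀ (by linarith) (by positivity) two_ne_zero
  have h3 : ‖x - p i‖ * δ ≤ l * δ := mul_le_mul_of_nonneg_right h0 hδ0.le
  linarith [add_sq ‖x - p i‖ δ, add_sq l δ]

/-! ### Intersections of lifted cells -/

theorem mem_iInter_liftedCell {σ : Finset (Fin (n + 1))} (hσ : σ.Nonempty) {α : ℝ}
    {z : Pt d × ℝ} :
    z ∈ ⋂ i ∈ σ, liftedCell ε p i α ↔
      z.2 ∈ Set.Icc 0 α ∧ ∀ i ∈ σ, z.1 ∈ clippedCell ε p z.2 i := by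
  obtain ⟨i, hi⟩ := hσ
  simp only [Set.mem_iInter, liftedCell, Set.mem_ofPred_eq]
  exact ⟨fun h => ⟨(h i hi).1, fun j hj => (h j hj).2⟩, fun h j hj => ⟨h.1, h.2 j hj⟩⟩

/-- Above the height at which the first vertex `i` of `σ` freezes, the heights that occur in the
common cell form an interval on which the squared radii are affine in the squared height. -/
theorem exists_affine_sq_cappedRadius (hε : 0 < ε) (hp : IsGreedyOrdering p) {α : ℝ} (hα : 0 ≤ α)
    (i : Fin (n + 1)) :
    ∃ (J : Set ℝ) (A B : Fin (n + 1) → ℝ), Convex ℝ J ∧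
      (∀ t ∈ J, cappedRadius ε p α i ^ 2 ≤ t ∧ t ≤ α ^ 2 ∧
        ∀ l, cappedRadius ε p (√t) l ^ 2 = A l + B l * t) ∧
      ∀ t x, cappedRadius ε p α i ^ 2 ≤ t → √t ≤ α → x ∈ clippedCell ε p (√t) i → t ∈ J := by
  rcases le_or_gt (ENNReal.ofReal α) (freezingTime ε p i) with h | h
  · -- The only height left is `α`.
    refine ⟨{α ^ 2}, fun l => cappedRadius ε p α l ^ 2, 0, convex_singleton _, ?_, ?_⟩
    · rintro t rfl
      simp [cappedRadius_of_le hα h, Real.sqrt_sq hα]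
    · intro t x h1 h2 _
      rw [cappedRadius_of_le hα h] at h1
      exact le_antisymm ((Real.sqrt_le_left hα).1 h2) h1
  · have hfin : freezingTime ε p i ≠ ∞ := (h.trans_le le_top).ne
    have hpos := freezingTime_toReal_pos hε hfin
    rw [cappedRadius_of_ge h.le]
    set L := (freezingTime ε p i).toReal with hL
    classical
    -- Points frozen by the time `L` keep their radii, and the others stay unfrozen below
    -- `(1 + ε) * L`.
    refine ⟨Set.Icc (L ^ 2) (α ^ 2) ∩ Set.Iio (((1 + ε) * L) ^ 2),
      fun l => if freezingTime ε p l ≤ freezingTime ε p i then (freezingTime ε p l).toReal ^ 2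
        else 0,
      fun l => if freezingTime ε p l ≤ freezingTime ε p i then 0 else 1,
      (convex_Icc _ _).inter (convex_Iio _), ?_, ?_⟩
    · rintro t ⟨⟨h1, h2⟩, h3⟩
      refine ⟨h1, h2, fun l => ?_⟩
      have hlow : freezingTime ε p i ≤ ENNReal.ofReal (√t) := by
        rw [← ENNReal.ofReal_toReal hfin]
        exact ENNReal.ofReal_le_ofReal (Real.le_sqrt_of_sq_le h1)
      have hhigh : √t ≤ (1 + ε) * L := (Real.sqrt_le_left (by positivity)).2 (le_of_lt h3)
      beta_reduce
      split_ifs with hl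
      · rw [cappedRadius_of_ge (hl.trans hlow)]
        ring
      · rw [cappedRadius_of_le (Real.sqrt_nonneg t)
          ((ENNReal.ofReal_le_ofReal hhigh).trans (freezingTime_gap hε (not_le.1 hl))),
          Real.sq_sqrt ((sq_nonneg L).trans h1)]
        ring
    · intro t x h1 h2 hx
      refine ⟨⟨h1, (Real.sqrt_le_left hα).1 h2⟩, ?_⟩
      exact (Real.sqrt_lt' (by positivity)).1
        (lt_of_mem_clippedCell hε hp (Real.sqrt_nonneg t) hx hfin)

theorem contractibleSpace_iInter_liftedCell (hε : 0 < ε) (hp : IsGreedyOrdering p) {α : ℝ}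
    (hα : 0 ≤ α) {σ : Finset (Fin (n + 1))} (hσ : σ.Nonempty)
    (hne : (⋂ i ∈ σ, liftedCell ε p i α).Nonempty) :
    ContractibleSpace ↥(⋂ i ∈ σ, liftedCell ε p i α) := by
  obtain ⟨i, hi, hmin⟩ := σ.exists_min_image (freezingTime ε p) hσ
  obtain ⟨J, A, B, hJ, hJ1, hJ2⟩ := exists_affine_sq_cappedRadius hε hp hα i
  refine contractibleSpace_of_raise_of_convex (cappedRadius_nonneg (ε := ε) (p := p) α i)
    (fun z hz => ((mem_iInter_liftedCell hσ).1 hz).1.1) ?_ ?_ hne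
  · intro x γ γ' hx h1 h2
    rw [mem_iInter_liftedCell hσ] at hx ⊢
    have hγ : 0 ≤ γ := hx.1.1
    have h3 : ENNReal.ofReal γ' ≤ min (ENNReal.ofReal α) (freezingTime ε p i) :=
      (ENNReal.ofReal_le_iff_le_toReal
        (ne_top_of_le_ne_top ENNReal.ofReal_ne_top (min_le_left _ _))).2 h2
    refine ⟨⟨hγ.trans h1, (ENNReal.ofReal_le_ofReal_iff hα).1 (h3.trans (min_le_left _ _))⟩,
      fun j hj => ?_⟩
    exact clippedCell_subset_of_le hγ h1 ((h3.trans (min_le_right _ _)).trans (hmin j hj))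
      (hx.2 j hj)
  · convert convex_powerCells p (σ : Set (Fin (n + 1))) hJ A B using 1
    ext ⟨x, t⟩
    simp only [Set.mem_ofPred_eq, mem_iInter_liftedCell hσ, mem_clippedCell_iff (Real.sqrt_nonneg t),
      Finset.mem_coe]
    constructor
    · rintro ⟨h1, ⟨-, h2⟩, h3⟩
      have ht : t ∈ J := hJ2 t x h1 h2 ((mem_clippedCell_iff (Real.sqrt_nonneg t)).2 (h3 i hi))
      refine ⟨ht, fun j hj => ?_⟩
      simpa only [power, (hJ1 t ht).2.2, sub_nonpos] using h3 j hj
    · rintro ⟨ht, h3⟩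
      refine ⟨(hJ1 t ht).1, ⟨Real.sqrt_nonneg t, (Real.sqrt_le_left hα).2 (hJ1 t ht).2.1⟩,
        fun j hj => ?_⟩
      simpa only [power, (hJ1 t ht).2.2, sub_nonpos] using h3 j hj

theorem isGoodFilteredCover_liftedCell (hε : 0 < ε) (hp : IsGreedyOrdering p) :
    IsGoodFilteredCover (liftedCell ε p) (liftedOffset ε p) where
  filtered _ _ _ _ h _ hz := ⟨⟨hz.1.1, hz.1.2.trans h⟩, hz.2⟩
  cover α _ := by
    ext z
    simp only [Set.mem_iUnion, liftedCell, liftedOffset, Set.mem_ofPred_eq, exists_and_left]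
    refine and_congr_right fun h => ?_
    rw [← iUnion_clippedCell h.1, Set.mem_iUnion]
  good _ hα _ hσ := contractibleSpace_iInter_liftedCell hε hp hα hσ.1 hσ.2

theorem nerve_liftedCell (ε : ℝ) (p : Fin (n + 1) → Pt d) (α : ℝ) :
    nerve (fun i => liftedCell ε p i α) = sparseDelaunay ε p α := by
  ext σ
  simp only [sparseDelaunay, delaunay, nerve, Set.mem_iUnion, Set.mem_ofPred_eq, exists_prop]
  constructor
  · rintro ⟨hσ, z, hz⟩
    rw [mem_iInter_liftedCell hσ] at hz
    exact ⟨z.2, hz.1, hσ, z.1, Set.mem_iInter₂.2 hz.2⟩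
  · rintro ⟨γ, hγ, hσ, x, hx⟩
    exact ⟨hσ, (x, γ), (mem_iInter_liftedCell hσ).2 ⟨hγ, Set.mem_iInter₂.1 hx⟩⟩

/-! ### The projection to the offset -/

/-- The projection of the lifted offset to the offset; its homotopy inverse is the inclusion at the
top height. -/
noncomputable def projectionHomotopyEquiv (ε : ℝ) (p : Fin (n + 1) → Pt d) {α : ℝ} (hα : 0 ≤ α) :
    ↥(liftedOffset ε p α) ≃ₕ ↥(offset ε p α) where
  toFun :=
    { toFun := fun z => ⟨z.1.1, offset_mono z.2.1.1 z.2.1.2 z.2.2⟩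
      continuous_toFun := by fun_prop }
  invFun :=
    { toFun := fun x => ⟨(x.1, α), ⟨hα, le_rfl⟩, x.2⟩
      continuous_toFun := by fun_prop }
  left_inv := ⟨(raiseHomotopy hα (fun _ hz => hz.1.1)
    (fun _ _ _ hx h1 h2 =>
      And.intro ⟨hx.1.1.trans h1, h2⟩ (offset_mono hx.1.1 h1 hx.2)) _
    (fun z => by simp [max_eq_right z.2.1.2])).symm⟩
  right_inv := ContinuousMap.Homotopic.refl _

end SparseDelaunay

theorem mainTheorem3 {d n : ℕ} (ε : ℝ) (hε : 0 < ε)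
    (p : Fin (n + 1) → SparseDelaunay.Pt d) (hp : SparseDelaunay.IsGreedyOrdering p) :
    SparseDelaunay.IsGoodFilteredCover
        (SparseDelaunay.liftedCell ε p) (SparseDelaunay.liftedOffset ε p) ∧
      (∀ α : ℝ, 0 ≤ α →
        SparseDelaunay.nerve (fun i => SparseDelaunay.liftedCell ε p i α) =
          SparseDelaunay.sparseDelaunay ε p α) ∧
      (∀ α : ℝ, 0 ≤ α →
        ∃ m : ↥(SparseDelaunay.liftedOffset ε p α) ≃ₕ ↥(SparseDelaunay.offset ε p α),
          ∀ z, (m z : SparseDelaunay.Pt d) = z.1.1) :=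
  ⟨SparseDelaunay.isGoodFilteredCover_liftedCell hε hp,
    fun α _ => SparseDelaunay.nerve_liftedCell ε p α,
    fun _ hα => ⟨SparseDelaunay.projectionHomotopyEquiv ε p hα, fun _ => rfl⟩⟩
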